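/- Let $n\ge 1$ and let $\mathcal S_n$ be the Shi arrangement of type $A$ in $\mathbb R^n$, i.e. the finite set of affine hyperplanes $$x_i-x_j=0,\qquad x_i-x_j=1\qquad(1\le i<j\le n).$$ For a finite arrangement $\mathcal A$ of affine subspaces, let $L(\mathcal A)$ be the set of all nonempty intersections of members of $\mathcal A$ (including the whole space, as the empty intersection), ordered by reverse inclusion, let $\mu$ be its Möbius function, and let $$\chi(\mathcal A,t)=\sum_{X\in L(\mathcal A)}\mu(\hat 0,X)\,t^{\dim X}$$ be the characteristic polynomial, where $\hat 0$ is the whole space. Then: 1. $\chi(\mathcal S_n,t)=t(t-n)^{n-1}$ as polynomials in $t$. 2. $\mathcal S_n$ has exactly $(n+1)^{n-1}$ regions, that is, $\mathbb R^n\setminus\bigcup\mathcal S_n$ has exactly $(n+1)^{n-1}$ connected components. 3. For every prime $p\ge n$, exactly $p(p-n)^{n-1}$ points of $\mathbb F_p^n$ lie on none of the hyperplanes $x_i-x_j=0$, $x_i-x_j=1$ $(1\le i<j\le n)$ over $\mathbb F_p$. -/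

import Mathlib

noncomputable section

open Classical in
/-- The Möbius function of a finite partially ordered set. -/
def poMoebius {P : Type*} [PartialOrder P] [Finite P] (x y : P) : ℤ :=
  letI : Fintype P := Fintype.ofFinite P
  letI : LocallyFiniteOrder P := Fintype.toLocallyFiniteOrder
  IncidenceAlgebra.mu ℤ x y

/-- The intersection poset of a finite arrangement of affine subspaces of a vector space `V`:
the nonempty affine subspaces that are intersections of some members of the arrangement (the
empty intersection being `V`). It is ordered by reverse inclusion, whence the order dual. -/
abbrev IntersectionPoset {K V : Type*} [Field K] [AddCommGroup V] [Module K V]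
    (A : Finset (AffineSubspace K V)) : Type _ :=
  {X : (AffineSubspace K V)ᵒᵈ //
    ((OrderDual.ofDual X : AffineSubspace K V) : Set V).Nonempty ∧
      ∃ B : Set (AffineSubspace K V), B ⊆ (A : Set (AffineSubspace K V)) ∧
        OrderDual.ofDual X = sInf B}

namespace IntersectionPoset

variable {K V : Type*} [Field K] [AddCommGroup V] [Module K V]
  (A : Finset (AffineSubspace K V))

/-- The underlying affine subspace of an element of the intersection poset. -/
def flat {A : Finset (AffineSubspace K V)} (X : IntersectionPoset A) : AffineSubspace K V :=
  OrderDual.ofDual X.1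

instance instFinite : Finite (IntersectionPoset A) := by
  have h : ((fun B : Set (AffineSubspace K V) => OrderDual.toDual (sInf B)) ''
      {B | B ⊆ (A : Set (AffineSubspace K V))}).Finite :=
    (A.finite_toSet.finite_subsets).image _
  refine (h.subset ?_).to_subtype
  rintro X ⟨-, B, hB, hX⟩
  exact ⟨B, hB, congrArg OrderDual.toDual hX.symm⟩

/-- The least element of the intersection poset is the whole space. -/
instance instOrderBot : OrderBot (IntersectionPoset A) where
  bot := ⟨OrderDual.toDual ⊤, ⟨(0 : V), AffineSubspace.mem_top K V (0 : V)⟩, ∅, Set.empty_subset _, by simp⟩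
  bot_le X := show OrderDual.ofDual X.1 ≤ (⊤ : AffineSubspace K V) from le_top

end IntersectionPoset

/-- The characteristic polynomial `∑_X μ(0̂, X) t ^ dim X` of a finite arrangement of affine
subspaces, where `X` ranges over the intersection poset. -/
def arrangementCharpoly {K V : Type*} [Field K] [AddCommGroup V] [Module K V]
    (A : Finset (AffineSubspace K V)) : Polynomial ℤ :=
  letI : Fintype (IntersectionPoset A) := Fintype.ofFinite _
  ∑ X : IntersectionPoset A,
    Polynomial.C (poMoebius ⊥ X) * Polynomial.X ^ Module.finrank K X.flat.direction

/-- The complement of the union of the members of an arrangement. -/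
def arrangementComplement {K V : Type*} [Field K] [AddCommGroup V] [Module K V]
    (A : Finset (AffineSubspace K V)) : Set V :=
  (⋃ H ∈ A, (H : Set V))ᶜ

/-- The number of regions of an arrangement in `ℝⁿ`: the number of connected components of the
complement. -/
def numRegions {n : ℕ} (A : Finset (AffineSubspace ℝ (Fin n → ℝ))) : ℕ :=
  Nat.card (ConnectedComponents (arrangementComplement A))

/-- The affine subspace `x_i - x_j = c` of `Kⁿ`. -/
def differenceHyperplane (K : Type*) [Field K] {n : ℕ} (i j : Fin n) (c : K) :
    AffineSubspace K (Fin n → K) where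
  carrier := {x | x i - x j = c}
  smul_vsub_vadd_mem' a x y z hx hy hz := by
    simp only [Set.mem_ofPred_eq, vsub_eq_sub, vadd_eq_add, Pi.add_apply, Pi.smul_apply,
      Pi.sub_apply, smul_eq_mul] at *
    linear_combination a * hx - a * hy + hz

open Classical in
/-- The Shi arrangement of type A in `Kⁿ`: the hyperplanes `x_i - x_j = 0` and `x_i - x_j = 1`
for `i < j`. -/
def shiArrangement (K : Type*) [Field K] (n : ℕ) : Finset (AffineSubspace K (Fin n → K)) :=
  ({q : Fin n × Fin n | q.1 < q.2} : Finset (Fin n × Fin n)).image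
      (fun q => differenceHyperplane K q.1 q.2 0) ∪
    ({q : Fin n × Fin n | q.1 < q.2} : Finset (Fin n × Fin n)).image
      (fun q => differenceHyperplane K q.1 q.2 1)

end

/-!
Write `w(W, E, t)` for the sum of `(-1) ^ |B| * t ^ dim (W ∩ ⋂ B)` over the subfamilies `B` of a
finite family `E` of hyperplanes for which `W ∩ ⋂ B` is nonempty (`whitneySum`). All three parts of
the theorem are statements about this sum.

* Characteristic polynomial: for a flat `X`, the signs of the subfamilies with intersection `X`
  add up to `μ(0̂, X)`, because their sums over principal order ideals are alternating sums over the
  power set of the family of hyperplanes containing `X`. Hence `χ(t) = w(V, E, t)`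
  (`arrangementCharpoly_image`). The hyperplanes may be repeated, so that the arrangement can be
  indexed in the same way over all fields.
* Regions: `w(W, E ∪ {H}) = w(W, E) - w(W ∩ H, E)`, and the number of cells of `E` in `W`
  satisfies the same recursion with a plus sign unless `W ⊆ H`, as `H` cuts in two exactly the cells
  it meets. So the number of regions is `(-1) ^ dim V * χ(-1)` (`ncard_signPatterns`,
  `numRegions_image`).
* Points over `𝔽_p`: by inclusion–exclusion they number `w(V, E, p)` taken over `𝔽_p`
  (`card_arrangementComplement_image`). A system of equations `x_i - x_j = c` with integer `c` is
  solved in the same way over every field whose characteristic avoids finitely many primes, whence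
  this is `χ(p)` for all large `p` (`exists_whitneySum_zmod_eq`).

It remains to count the points of the complement over `ℤ / q` for `q ≥ n`. A point `x` is a placement
of `n` labels on a cycle of `q` positions such that adjacent labels increase. If the position `0`
is free, the other `q - n - 1` free positions bound `q - n` gaps, the labels may be
distributed among the gaps at will, and they are sorted within a gap: `(q - n) ^ n` placements.
Counting pairs of a placement and a free position yields `q * (q - n) ^ (n - 1)`
(`card_cyclicPlacement`). Therefore `χ(t) = t * (t - n) ^ (n - 1)`, because both sides agree at all
large primes, and the number of regions is its value at `-1` up to sign.
-/

/-! ### The Möbius function and Whitney's theorem -/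

/-- The signed count of the subfamilies of `(H e)_{e ∈ E}` which meet the flat `W` in a nonempty
affine subspace, a subfamily `B` being weighted by `(-1) ^ |B| * t ^ dim (W ∩ ⋂_{e ∈ B} H e)`. -/
noncomputable def whitneySum {K V ι R : Type*} [Field K] [AddCommGroup V] [Module K V] [CommRing R]
    (H : ι → AffineSubspace K V) (t : R) (W : AffineSubspace K V) (E : Finset ι) : R :=
  open Classical in
  ∑ B ∈ E.powerset, if W ⊓ B.inf H = ⊥ then 0 else
    (-1) ^ B.card * t ^ Module.finrank K (W ⊓ B.inf H).direction

/-- The Möbius function is the only function whose sums over principal order ideals are the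
indicator of the least element. -/
theorem poMoebius_bot_eq {P : Type*} [PartialOrder P] [Fintype P] [OrderBot P] [DecidableEq P]
    [DecidableLE P]
    (ν : P → ℤ) (h : ∀ x, ∑ y with y ≤ x, ν y = if x = ⊥ then 1 else 0) (x : P) :
    poMoebius ⊥ x = ν x := by
  classical
  unfold poMoebius
  let : Fintype P := Fintype.ofFinite P
  let : LocallyFiniteOrder P := Fintype.toLocallyFiniteOrder
  let : LocallyFiniteOrderBot P := LocallyFiniteOrder.toLocallyFiniteOrderBot
  have key := IncidenceAlgebra.moebius_inversion_bot ν (fun x : P => if x = ⊥ then (1 : ℤ) else 0)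
    (fun x => by
      rw [← h x]
      refine Finset.sum_congr ?_ fun _ _ => rfl
      ext y
      simp) x
  rw [key]
  simp only [mul_ite, mul_one, mul_zero, Finset.sum_ite_eq', Finset.mem_Iic, bot_le, if_true]
  convert! rfl

open Classical in
/-- **Whitney's theorem**, for an indexed family (in which a subspace may occur several times). -/
theorem arrangementCharpoly_image {K V ι : Type*} [Field K] [AddCommGroup V] [Module K V]
    (H : ι → AffineSubspace K V) (E : Finset ι) (hH : ∀ e ∈ E, H e ≠ ⊤) :
    arrangementCharpoly (E.image H) = whitneySum H (Polynomial.X : Polynomial ℤ) ⊤ E := by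
  unfold arrangementCharpoly whitneySum
  let : Fintype (IntersectionPoset (E.image H)) := Fintype.ofFinite _
  have hflat : ∀ B ∈ E.powerset, ∃ B' ⊆ ((E.image H : Finset _) : Set (AffineSubspace K V)),
      B.inf H = sInf B' := by
    intro B hB
    refine ⟨((B.image H : Finset _) : Set _), ?_, ?_⟩
    · exact_mod_cast Finset.image_subset_image (Finset.mem_powerset.1 hB)
    · rw [Finset.inf_eq_iInf, Finset.coe_image, sInf_image]
      rfl
  have hflat' : ∀ X : IntersectionPoset (E.image H), ∃ B ∈ E.powerset, B.inf H = X.flat := by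
    rintro ⟨X, hX, B', hB', hXB⟩
    refine ⟨E.filter fun e => H e ∈ B', Finset.mem_powerset.2 (Finset.filter_subset _ _), ?_⟩
    rw [IntersectionPoset.flat, hXB]
    apply le_antisymm
    · refine le_sInf fun b hb => ?_
      obtain ⟨e, he, rfl⟩ := Finset.mem_image.1 (Finset.mem_coe.1 (hB' hb))
      exact Finset.inf_le (Finset.mem_filter.2 ⟨he, hb⟩)
    · exact Finset.le_inf fun e he => sInf_le (Finset.mem_filter.1 he).2
  have hmu : ∀ X : IntersectionPoset (E.image H), poMoebius ⊥ X =
      ∑ B ∈ E.powerset with B.inf H = X.flat, (-1 : ℤ) ^ B.card := by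
    refine poMoebius_bot_eq _ fun X => ?_
    -- the subfamilies whose intersection contains `X` are those made of members containing `X`
    have h1 : ∑ Y with Y ≤ X, ∑ B ∈ E.powerset with B.inf H = Y.flat, (-1 : ℤ) ^ B.card =
        ∑ B ∈ (E.filter fun e => X.flat ≤ H e).powerset, (-1 : ℤ) ^ B.card := by
      rw [Finset.sum_comm' (t' := (E.filter fun e => X.flat ≤ H e).powerset)
        (s' := fun B => Finset.univ.filter fun Y => B.inf H = Y.flat)]
      · refine Finset.sum_congr rfl fun B hB => ?_
        have hB' : B ∈ E.powerset :=
          Finset.mem_powerset.2 ((Finset.mem_powerset.1 hB).trans (Finset.filter_subset _ _))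
        have hX : X.flat ≤ B.inf H := Finset.le_inf fun e he =>
          (Finset.mem_filter.1 (Finset.mem_powerset.1 hB he)).2
        have : (Finset.univ.filter fun Y : IntersectionPoset (E.image H) => B.inf H = Y.flat) =
            {⟨OrderDual.toDual (B.inf H), X.2.1.mono hX, hflat B hB'⟩} := by
          ext Y
          simp only [Finset.mem_filter, Finset.mem_univ, true_and, Finset.mem_singleton]
          constructor
          · intro h
            exact Subtype.ext (congrArg OrderDual.toDual h.symm)
          · rintro rfl
            rfl
        rw [this, Finset.sum_singleton]
      · intro Y B
        simp only [Finset.mem_filter, Finset.mem_univ, true_and, Finset.mem_powerset]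
        constructor
        · rintro ⟨hYX, hB, hBY⟩
          refine ⟨hBY, fun e he => Finset.mem_filter.2 ⟨hB he, ?_⟩⟩
          have h2 : X.flat ≤ Y.flat := hYX
          exact (h2.trans hBY.symm.le).trans (Finset.inf_le he)
        · rintro ⟨hBY, hB⟩
          refine ⟨?_, hB.trans (Finset.filter_subset _ _), hBY⟩
          change X.flat ≤ Y.flat
          rw [← hBY]
          exact Finset.le_inf fun e he => (Finset.mem_filter.1 (hB he)).2
    rw [h1, Finset.sum_powerset_neg_one_pow_card]
    refine if_congr ?_ rfl rfl
    obtain ⟨B, hB, hBX⟩ := hflat' X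
    constructor
    · intro h0
      have hB0 : B = ∅ := by
        rw [← Finset.subset_empty, ← h0]
        intro e he
        exact Finset.mem_filter.2 ⟨Finset.mem_powerset.1 hB he, hBX ▸ Finset.inf_le he⟩
      subst hB0
      exact Subtype.ext (congrArg OrderDual.toDual hBX.symm)
    · rintro rfl
      refine Finset.filter_eq_empty_iff.2 fun e he hle => hH e he (top_le_iff.1 hle)
  simp_rw [hmu, map_sum, Finset.sum_mul]
  rw [Finset.sum_comm' (t' := E.powerset)
    (s' := fun B => Finset.univ.filter fun Y => B.inf H = Y.flat) (by simp [and_comm])]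
  refine Finset.sum_congr rfl fun B hB => ?_
  rw [top_inf_eq]
  split_ifs with h
  · refine Finset.sum_eq_zero fun Y hY => ?_
    have hY' : B.inf H = Y.flat := (Finset.mem_filter.1 hY).2
    have hne : (Y.flat : Set V).Nonempty := Y.2.1
    rw [← hY', h] at hne
    simp at hne
  · have hne : ((B.inf H : AffineSubspace K V) : Set V).Nonempty :=
      (AffineSubspace.nonempty_iff_ne_bot _).2 h
    have : (Finset.univ.filter fun Y : IntersectionPoset (E.image H) => B.inf H = Y.flat) =
        {⟨OrderDual.toDual (B.inf H), hne, hflat B hB⟩} := by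
      ext Y
      simp only [Finset.mem_filter, Finset.mem_univ, true_and, Finset.mem_singleton]
      constructor
      · intro h
        exact Subtype.ext (congrArg OrderDual.toDual h.symm)
      · rintro rfl
        rfl
    rw [this, Finset.sum_singleton]
    rw [map_pow, map_neg, map_one]
    rfl

/-! ### Deletion–restriction and Zaslavsky's theorem -/

section WhitneySum

variable {K V ι R : Type*} [Field K] [AddCommGroup V] [Module K V] [CommRing R]

theorem whitneySum_empty_of_ne_bot (H : ι → AffineSubspace K V) (t : R) {W : AffineSubspace K V}
    (hW : W ≠ ⊥) : whitneySum H t W ∅ = t ^ Module.finrank K W.direction := by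
  rw [whitneySum, Finset.powerset_empty, Finset.sum_singleton, Finset.inf_empty, inf_top_eq,
    if_neg hW, Finset.card_empty, pow_zero, one_mul]

theorem whitneySum_bot (H : ι → AffineSubspace K V) (t : R) (E : Finset ι) :
    whitneySum H t ⊥ E = 0 := by
  simp [whitneySum]

theorem map_whitneySum {S : Type*} [CommRing S] (φ : R →+* S) (H : ι → AffineSubspace K V) (t : R)
    (W : AffineSubspace K V) (E : Finset ι) :
    φ (whitneySum H t W E) = whitneySum H (φ t) W E := by
  simp only [whitneySum, map_sum, apply_ite φ, map_zero, map_mul, map_pow, map_neg, map_one]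

/-- Deletion–restriction for the signed count of subfamilies. -/
theorem whitneySum_insert [DecidableEq ι] (H : ι → AffineSubspace K V) (t : R)
    (W : AffineSubspace K V) {e : ι} {E : Finset ι} (he : e ∉ E) :
    whitneySum H t W (insert e E) = whitneySum H t W E - whitneySum H t (W ⊓ H e) E := by
  unfold whitneySum
  rw [Finset.sum_powerset_insert he, sub_eq_add_neg, ← Finset.sum_neg_distrib]
  congr 1
  refine Finset.sum_congr rfl fun B hB => ?_
  have heB : e ∉ B := fun h => he (Finset.mem_powerset.1 hB h)
  rw [Finset.inf_insert, ← inf_assoc, Finset.card_insert_of_notMem heB]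
  split_ifs <;> ring

end WhitneySum

section Patterns

variable {V ι : Type*} [AddCommGroup V] [Module ℝ V]

open Classical in
/-- The set of indices in `E` whose affine functional is positive at `x`. Off the zero sets of the
functionals, it records all their signs. -/
noncomputable def signPattern (f : ι → V →ᵃ[ℝ] ℝ) (E : Finset ι) (x : V) : Finset ι :=
  E.filter fun e => 0 < f e x

/-- The sign patterns of the points of a flat `W` at which none of the functionals vanishes. -/
def signPatterns (f : ι → V →ᵃ[ℝ] ℝ) (W : AffineSubspace ℝ V) (E : Finset ι) : Set (Finset ι) :=
  signPattern f E '' {x | x ∈ W ∧ ∀ e ∈ E, f e x ≠ 0}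

theorem mem_signPattern {f : ι → V →ᵃ[ℝ] ℝ} {E : Finset ι} {x : V} {e : ι} :
    e ∈ signPattern f E x ↔ e ∈ E ∧ 0 < f e x := by
  simp [signPattern]

theorem signPattern_eq_iff {f : ι → V →ᵃ[ℝ] ℝ} {E : Finset ι} {x y : V} :
    signPattern f E x = signPattern f E y ↔ ∀ e ∈ E, (0 < f e x ↔ 0 < f e y) := by
  simp only [Finset.ext_iff, mem_signPattern, and_congr_right_iff]

theorem signPattern_insert [DecidableEq ι] {f : ι → V →ᵃ[ℝ] ℝ} {E : Finset ι} {x : V} {e : ι} :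
    signPattern f (insert e E) x =
      if 0 < f e x then insert e (signPattern f E x) else signPattern f E x := by
  ext e'
  split_ifs with h <;> simp only [mem_signPattern, Finset.mem_insert] <;> grind

theorem finite_signPatterns (f : ι → V →ᵃ[ℝ] ℝ) (W : AffineSubspace ℝ V) (E : Finset ι) :
    (signPatterns f W E).Finite := by
  refine E.powerset.finite_toSet.subset ?_
  rintro _ ⟨x, -, rfl⟩
  simp only [Finset.coe_powerset, Set.mem_preimage, Set.mem_powerset_iff, Finset.coe_subset]
  exact fun e he => (mem_signPattern.1 he).1

theorem affineMap_lineMap_apply (g : V →ᵃ[ℝ] ℝ) (x y : V) (t : ℝ) :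
    g (AffineMap.lineMap x y t) = (1 - t) * g x + t * g y := by
  rw [AffineMap.apply_lineMap, AffineMap.lineMap_apply_ring]

/-- The points of a segment between two points of equal sign pattern have that pattern. -/
theorem signPattern_lineMap {f : ι → V →ᵃ[ℝ] ℝ} {E : Finset ι} {x y : V} {t : ℝ}
    (hx : ∀ e ∈ E, f e x ≠ 0) (hy : ∀ e ∈ E, f e y ≠ 0)
    (hxy : signPattern f E x = signPattern f E y) (ht : t ∈ Set.Icc (0 : ℝ) 1) :
    (∀ e ∈ E, f e (AffineMap.lineMap x y t) ≠ 0) ∧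
      signPattern f E (AffineMap.lineMap x y t) = signPattern f E x := by
  have key : ∀ e ∈ E, f e (AffineMap.lineMap x y t) ≠ 0 ∧
      (0 < f e (AffineMap.lineMap x y t) ↔ 0 < f e x) := by
    intro e he
    rw [affineMap_lineMap_apply]
    have h := signPattern_eq_iff.1 hxy e he
    obtain ⟨h0, h1⟩ := ht
    rcases (hx e he).lt_or_gt with h2 | h2
    · have h3 : f e y < 0 := (hy e he).lt_or_gt.resolve_right fun h' => lt_asymm h2 (h.2 h')
      have h4 : (1 - t) * f e x + t * f e y < 0 := by
        rcases h0.eq_or_lt with rfl | h0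
        · linarith
        · nlinarith [mul_nonneg (sub_nonneg.2 h1) (neg_nonneg.2 h2.le), mul_pos h0 (neg_pos.2 h3)]
      exact ⟨h4.ne, ⟨fun h => absurd h h4.not_gt, fun h => absurd h h2.not_gt⟩⟩
    · have h3 : 0 < f e y := h.1 h2
      have h4 : 0 < (1 - t) * f e x + t * f e y := by
        rcases h0.eq_or_lt with rfl | h0
        · linarith
        · nlinarith [mul_nonneg (sub_nonneg.2 h1) h2.le, mul_pos h0 h3]
      exact ⟨h4.ne', ⟨fun _ => h2, fun _ => h4⟩⟩
  exact ⟨fun e he => (key e he).1, signPattern_eq_iff.2 fun e he => (key e he).2⟩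

/-- Small displacements do not change the sign pattern. -/
theorem exists_pos_signPattern_lineMap {f : ι → V →ᵃ[ℝ] ℝ} {E : Finset ι} {x : V} (y : V)
    (hx : ∀ e ∈ E, f e x ≠ 0) :
    ∃ δ > (0 : ℝ), ∀ t : ℝ, |t| < δ → (∀ e ∈ E, f e (AffineMap.lineMap x y t) ≠ 0) ∧
      signPattern f E (AffineMap.lineMap x y t) = signPattern f E x := by
  have h : ∀ᶠ t : ℝ in nhds 0, ∀ e ∈ E, f e (AffineMap.lineMap x y t) ≠ 0 ∧
      (0 < f e (AffineMap.lineMap x y t) ↔ 0 < f e x) := by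
    rw [Filter.eventually_all_finset]
    intro e he
    have hc : ContinuousAt (fun t : ℝ => f e (AffineMap.lineMap x y t)) 0 := by
      simp only [affineMap_lineMap_apply]
      fun_prop
    have h0 : f e (AffineMap.lineMap x y (0 : ℝ)) = f e x := by simp
    rcases (hx e he).lt_or_gt with h2 | h2
    · filter_upwards [hc.eventually_lt_const (h0.trans_lt h2)] with t ht
      exact ⟨ht.ne, ⟨fun h => absurd h ht.not_gt, fun h => absurd h h2.not_gt⟩⟩
    · filter_upwards [hc.eventually_const_lt (h2.trans_eq h0.symm)] with t ht
      exact ⟨ht.ne', ⟨fun _ => h2, fun _ => ht⟩⟩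
  obtain ⟨δ, hδ, h⟩ := Metric.eventually_nhds_iff.1 h
  refine ⟨δ, hδ, fun t ht => ?_⟩
  have h' := h (y := t) (by simpa using ht)
  exact ⟨fun e he => (h' e he).1, signPattern_eq_iff.2 fun e he => (h' e he).2⟩

/-- Deletion–restriction for sign patterns: the hyperplane of `e` cuts in two exactly those cells
of `W` which it meets. -/
theorem ncard_signPatterns_insert [DecidableEq ι] {f : ι → V →ᵃ[ℝ] ℝ}
    {H : ι → AffineSubspace ℝ V} (hH : ∀ e x, x ∈ H e ↔ f e x = 0) {W : AffineSubspace ℝ V}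
    {e : ι} {E : Finset ι} (he : e ∉ E) (hW : ¬ W ≤ H e) :
    (signPatterns f W (insert e E)).ncard =
      (signPatterns f W E).ncard + (signPatterns f (W ⊓ H e) E).ncard := by
  set Sp : Set (Finset ι) :=
    signPattern f E '' {x | (x ∈ W ∧ ∀ e ∈ E, f e x ≠ 0) ∧ 0 < f e x} with hSp
  set Sm : Set (Finset ι) :=
    signPattern f E '' {x | (x ∈ W ∧ ∀ e ∈ E, f e x ≠ 0) ∧ f e x < 0} with hSm
  obtain ⟨y, hyW, hyH⟩ := Set.not_subset.1 hW
  have hy : f e y ≠ 0 := fun h => hyH ((hH e y).2 h)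
  have hinter : Sp ∩ Sm = signPatterns f (W ⊓ H e) E := by
    apply Set.Subset.antisymm
    · rintro _ ⟨⟨x, ⟨⟨hxW, hxE⟩, hx⟩, rfl⟩, ⟨z, ⟨⟨hzW, hzE⟩, hz⟩, hzx⟩⟩
      -- the segment from `x` to `z` crosses the hyperplane inside the cell
      set t : ℝ := f e x / (f e x - f e z) with ht
      have hd : 0 < f e x - f e z := by linarith
      have h1 := signPattern_lineMap (t := t) hxE hzE hzx.symm
        ⟨div_nonneg hx.le hd.le, (div_le_one hd).2 (by linarith)⟩
      refine ⟨AffineMap.lineMap x z t, ⟨⟨AffineMap.lineMap_mem t hxW hzW, ?_⟩, h1.1⟩, h1.2⟩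
      refine (hH e _).2 ?_
      rw [affineMap_lineMap_apply, ht]
      field_simp
      ring
    · rintro _ ⟨x, ⟨⟨hxW, hxH⟩, hxE⟩, rfl⟩
      have hx : f e x = 0 := (hH e x).1 hxH
      obtain ⟨δ, hδ, h⟩ := exists_pos_signPattern_lineMap y hxE
      have hmem : ∀ t, f e (AffineMap.lineMap x y t) = t * f e y := by
        intro t
        rw [affineMap_lineMap_apply, hx]
        ring
      have h1 : |δ / 2| < δ := by rw [abs_of_pos (by linarith)]; linarith
      have h2 : |-(δ / 2)| < δ := by rwa [abs_neg]
      have hW' : ∀ t : ℝ, AffineMap.lineMap x y t ∈ W := fun t =>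
        AffineMap.lineMap_mem t hxW hyW
      rcases hy.lt_or_gt with hy | hy
      · refine ⟨⟨_, ⟨⟨hW' (-(δ / 2)), (h _ h2).1⟩, ?_⟩, (h _ h2).2⟩,
          ⟨_, ⟨⟨hW' (δ / 2), (h _ h1).1⟩, ?_⟩, (h _ h1).2⟩⟩
        · rw [hmem]
          exact mul_pos_of_neg_of_neg (by linarith) hy
        · rw [hmem]
          exact mul_neg_of_pos_of_neg (by linarith) hy
      · refine ⟨⟨_, ⟨⟨hW' (δ / 2), (h _ h1).1⟩, ?_⟩, (h _ h1).2⟩,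
          ⟨_, ⟨⟨hW' (-(δ / 2)), (h _ h2).1⟩, ?_⟩, (h _ h2).2⟩⟩
        · rw [hmem]
          exact mul_pos (by linarith) hy
        · rw [hmem]
          exact mul_neg_of_neg_of_pos (by linarith) hy
  have hunion : Sp ∪ Sm = signPatterns f W E := by
    apply Set.Subset.antisymm
    · rintro _ (⟨x, ⟨hx, -⟩, rfl⟩ | ⟨x, ⟨hx, -⟩, rfl⟩) <;> exact ⟨x, hx, rfl⟩
    · rintro _ ⟨x, hx, rfl⟩
      rcases lt_trichotomy (f e x) 0 with h | h | h
      · exact Or.inr ⟨x, ⟨hx, h⟩, rfl⟩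
      · refine Or.inl (Set.inter_subset_left (hinter.symm ▸ ?_ : signPattern f E x ∈ Sp ∩ Sm))
        exact ⟨x, ⟨⟨hx.1, (hH e x).2 h⟩, hx.2⟩, rfl⟩
      · exact Or.inl ⟨x, ⟨hx, h⟩, rfl⟩
  have hfin : (Sp ∪ Sm).Finite := hunion ▸ finite_signPatterns f W E
  have hSpf : Sp.Finite := hfin.subset Set.subset_union_left
  have hSmf : Sm.Finite := hfin.subset Set.subset_union_right
  have heS : ∀ P ∈ Sp ∪ Sm, e ∉ P := by
    rw [hunion]
    rintro _ ⟨x, -, rfl⟩ h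
    exact he (mem_signPattern.1 h).1
  have hins : signPatterns f W (insert e E) = insert e '' Sp ∪ Sm := by
    ext P
    constructor
    · rintro ⟨x, ⟨hxW, hx⟩, rfl⟩
      have hxE : ∀ e' ∈ E, f e' x ≠ 0 := fun e' he' => hx e' (Finset.mem_insert_of_mem he')
      rw [signPattern_insert]
      rcases (hx e (Finset.mem_insert_self e E)).lt_or_gt with h | h
      · rw [if_neg h.not_gt]
        exact Or.inr ⟨x, ⟨⟨hxW, hxE⟩, h⟩, rfl⟩
      · rw [if_pos h]
        exact Or.inl ⟨_, ⟨x, ⟨⟨hxW, hxE⟩, h⟩, rfl⟩, rfl⟩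
    · rintro (⟨_, ⟨x, ⟨⟨hxW, hxE⟩, h⟩, rfl⟩, rfl⟩ | ⟨x, ⟨⟨hxW, hxE⟩, h⟩, rfl⟩)
      · refine ⟨x, ⟨hxW, Finset.forall_mem_insert _ _ _ |>.2 ⟨h.ne', hxE⟩⟩, ?_⟩
        rw [signPattern_insert, if_pos h]
      · refine ⟨x, ⟨hxW, Finset.forall_mem_insert _ _ _ |>.2 ⟨h.ne, hxE⟩⟩, ?_⟩
        rw [signPattern_insert, if_neg h.not_gt]
  have hdisj : Disjoint (insert e '' Sp) Sm := by
    rw [Set.disjoint_left]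
    rintro _ ⟨P, -, rfl⟩ h
    exact heS _ (Or.inr h) (Finset.mem_insert_self e P)
  have hinj : Set.InjOn (insert e) Sp := by
    intro P hP Q hQ h
    rw [← Finset.erase_insert (heS P (Or.inl hP)), h, Finset.erase_insert (heS Q (Or.inl hQ))]
  rw [hins, Set.ncard_union_eq hdisj (hSpf.image _) hSmf, hinj.ncard_image, ← hunion,
    ← hinter, Set.ncard_union_add_ncard_inter Sp Sm hSpf hSmf]

/-- A hyperplane section drops the dimension by one. -/
theorem finrank_direction_inf_add_one [FiniteDimensional ℝ V] {g : V →ᵃ[ℝ] ℝ}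
    {H W : AffineSubspace ℝ V} (hH : ∀ x, x ∈ H ↔ g x = 0) (hW : ¬ W ≤ H) (hWH : W ⊓ H ≠ ⊥) :
    Module.finrank ℝ (W ⊓ H).direction + 1 = Module.finrank ℝ W.direction := by
  obtain ⟨x, hxW, hxH⟩ := (AffineSubspace.nonempty_iff_ne_bot _).2 hWH
  obtain ⟨y, hyW, hyH⟩ := Set.not_subset.1 hW
  have hx : g x = 0 := (hH x).1 hxH
  have hlin : ∀ v, g (v +ᵥ x) = g.linear v := fun v => by rw [g.map_vadd, hx]; simp
  let φ : W.direction →ₗ[ℝ] ℝ := g.linear.domRestrict W.direction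
  have hφ : LinearMap.range φ = ⊤ := by
    refine LinearMap.range_eq_top.2 (LinearMap.surjective fun h => hyH ((hH y).2 ?_))
    have h1 := LinearMap.congr_fun h ⟨y -ᵥ x, AffineSubspace.vsub_mem_direction hyW hxW⟩
    rw [← vsub_vadd y x, hlin]
    exact h1
  have hker : (LinearMap.ker φ).map W.direction.subtype = (W ⊓ H).direction := by
    ext v
    rw [← AffineSubspace.vadd_mem_iff_mem_direction v (⟨hxW, hxH⟩ : x ∈ W ⊓ H),
      AffineSubspace.mem_inf_iff, hH, hlin, AffineSubspace.vadd_mem_iff_mem_direction v hxW]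
    simp only [Submodule.mem_map, LinearMap.mem_ker, Submodule.subtype_apply, Subtype.exists,
      exists_and_right, exists_eq_right]
    exact ⟨fun ⟨h1, h2⟩ => ⟨h1, h2⟩, fun ⟨h1, h2⟩ => ⟨h1, h2⟩⟩
  have h := φ.finrank_range_add_finrank_ker
  rw [hφ, finrank_top, Module.finrank_self] at h
  rw [← hker, Submodule.finrank_map_subtype_eq, ← h, add_comm]

/-- **Zaslavsky's theorem** for sign patterns. -/
theorem ncard_signPatterns [FiniteDimensional ℝ V] {f : ι → V →ᵃ[ℝ] ℝ}
    {H : ι → AffineSubspace ℝ V} (hH : ∀ e x, x ∈ H e ↔ f e x = 0) (E : Finset ι)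
    (W : AffineSubspace ℝ V) :
    ((signPatterns f W E).ncard : ℤ) =
      (-1) ^ Module.finrank ℝ W.direction * whitneySum H (-1 : ℤ) W E := by
  classical
  have hbot : ∀ E, signPatterns f ⊥ E = ∅ := fun E => by
    simp [signPatterns, AffineSubspace.notMem_bot]
  induction E using Finset.induction_on generalizing W with
  | empty =>
    by_cases hW : W = ⊥
    · subst hW
      rw [hbot, whitneySum_bot]
      simp
    · rw [whitneySum_empty_of_ne_bot H _ hW, ← pow_add, Even.neg_one_pow (Even.add_self _)]
      have : signPatterns f W ∅ = {∅} := by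
        obtain ⟨x, hx⟩ := (AffineSubspace.nonempty_iff_ne_bot _).2 hW
        refine Set.eq_singleton_iff_unique_mem.2 ⟨⟨x, ⟨hx, by simp⟩, by simp [signPattern]⟩, ?_⟩
        rintro _ ⟨x, -, rfl⟩
        simp [signPattern]
      simp [this]
  | insert e E he ih =>
    rw [whitneySum_insert H _ W he]
    by_cases hW : W ≤ H e
    · have : signPatterns f W (insert e E) = ∅ := by
        refine Set.image_eq_empty.2 (Set.eq_empty_iff_forall_notMem.2 ?_)
        rintro x ⟨hxW, hx⟩
        exact hx e (Finset.mem_insert_self e E) ((hH e x).1 (hW hxW))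
      rw [inf_eq_left.2 hW, this]
      simp
    · rw [ncard_signPatterns_insert hH he hW, Nat.cast_add, ih, ih]
      by_cases hWH : W ⊓ H e = ⊥
      · rw [hWH, whitneySum_bot]
        ring
      · rw [← finrank_direction_inf_add_one (hH e) hW hWH]
        ring

/-- The regions of an arrangement of hyperplanes are its cells, that is, the classes of points of
equal sign pattern: each is convex, and open because there are finitely many hyperplanes. -/
theorem numRegions_image {n : ℕ} {f : ι → (Fin n → ℝ) →ᵃ[ℝ] ℝ}
    {H : ι → AffineSubspace ℝ (Fin n → ℝ)} [DecidableEq (AffineSubspace ℝ (Fin n → ℝ))]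
    (hH : ∀ e x, x ∈ H e ↔ f e x = 0) (E : Finset ι) :
    numRegions (E.image H) = (signPatterns f ⊤ E).ncard := by
  have hmem : ∀ x, x ∈ arrangementComplement (E.image H) ↔ ∀ e ∈ E, f e x ≠ 0 := by
    intro x
    simp [arrangementComplement, hH]
  let _ : TopologicalSpace (Finset ι) := ⊥
  have : DiscreteTopology (Finset ι) := ⟨rfl⟩
  let φ : arrangementComplement (E.image H) → Finset ι := fun x => signPattern f E x
  have hφ : Continuous φ := by
    refine (IsLocallyConstant.iff_eventually_eq φ).2 (fun x => ?_) |>.continuous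
    have h : ∀ᶠ y : arrangementComplement (E.image H) in nhds x, ∀ e ∈ E, (0 < f e y ↔ 0 < f e x) := by
      rw [Filter.eventually_all_finset]
      intro e he
      have hc : ContinuousAt (fun y : arrangementComplement (E.image H) => f e y) x :=
        ((f e).continuous_of_finiteDimensional.comp continuous_subtype_val).continuousAt
      rcases ((hmem x).1 x.2 e he).lt_or_gt with h2 | h2
      · filter_upwards [hc.eventually_lt_const h2] with y hy
        exact ⟨fun h => absurd h hy.not_gt, fun h => absurd h h2.not_gt⟩
      · filter_upwards [hc.eventually_const_lt h2] with y hy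
        exact ⟨fun _ => h2, fun _ => hy⟩
    filter_upwards [h] with y hy
    exact signPattern_eq_iff.2 hy
  have hconn : ∀ x y, φ x = φ y →
      (x : ConnectedComponents (arrangementComplement (E.image H))) =
        (y : ConnectedComponents (arrangementComplement (E.image H))) := by
    intro x y hxy
    rw [ConnectedComponents.coe_eq_coe']
    have hpre : IsPreconnected (φ ⁻¹' {φ y}) := by
      rw [← Topology.IsInducing.subtypeVal.isPreconnected_image]
      refine Convex.isPreconnected ?_
      rw [convex_iff_segment_subset]
      rintro _ ⟨a, ha, rfl⟩ _ ⟨b, hb, rfl⟩ _ hz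
      rw [segment_eq_image_lineMap] at hz
      obtain ⟨t, ht, rfl⟩ := hz
      have h1 := signPattern_lineMap ((hmem a).1 a.2) ((hmem b).1 b.2)
        (Eq.trans ha (Eq.symm hb) : φ a = φ b) ht
      exact ⟨⟨_, (hmem _).2 h1.1⟩, h1.2.trans ha, rfl⟩
    exact hpre.subset_connectedComponent rfl hxy
  unfold numRegions
  rw [← Nat.card_coe_set_eq]
  refine Nat.card_congr (Equiv.ofBijective
    (fun c => ⟨hφ.connectedComponentsLift c, ?_⟩) ⟨?_, ?_⟩)
  · obtain ⟨x, rfl⟩ := ConnectedComponents.surjective_coe c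
    exact ⟨x, ⟨AffineSubspace.mem_top _ _ _, (hmem x).1 x.2⟩, rfl⟩
  · intro c d h
    obtain ⟨x, rfl⟩ := ConnectedComponents.surjective_coe c
    obtain ⟨y, rfl⟩ := ConnectedComponents.surjective_coe d
    exact hconn x y (congrArg Subtype.val h)
  · rintro ⟨_, x, ⟨-, hx⟩, rfl⟩
    exact ⟨((⟨x, (hmem x).2 hx⟩ : arrangementComplement (E.image H)) :
      ConnectedComponents _), rfl⟩

end Patterns

/-! ### Counting points over finite fields -/

/-- Over a finite field, the signed count of subfamilies at the number of scalars counts the points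
of the complement, by inclusion–exclusion. -/
theorem card_arrangementComplement_image {K V ι : Type*} [Field K] [Finite K] [AddCommGroup V]
    [Module K V] [Finite V] [DecidableEq (AffineSubspace K V)]
    (H : ι → AffineSubspace K V) (E : Finset ι) :
    (Nat.card (arrangementComplement (E.image H)) : ℤ) =
      whitneySum H (Nat.card K : ℤ) ⊤ E := by
  classical
  have : Fintype V := Fintype.ofFinite V
  let S : ι → Finset V := fun e => Finset.univ.filter fun x => x ∈ H e
  have hmem : ∀ (B : Finset ι) x, x ∈ B.inf S ↔ x ∈ B.inf H := by
    intro B x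
    rw [Finset.mem_inf, Finset.inf_eq_iInf]
    simp [S, AffineSubspace.mem_iInf_iff]
  have hcompl : Nat.card (arrangementComplement (E.image H)) =
      (E.inf fun e => (S e)ᶜ).card := by
    rw [Nat.card_coe_set_eq, ← Set.ncard_coe_finset]
    congr 1
    ext x
    rw [Finset.mem_coe, Finset.mem_inf]
    simp [arrangementComplement, S]
  rw [hcompl, Finset.inclusion_exclusion_card_inf_compl, whitneySum]
  refine Finset.sum_congr rfl fun B _ => ?_
  rw [top_inf_eq]
  split_ifs with h
  · have : B.inf S = ∅ := by
      ext x
      rw [hmem, h]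
      simp [AffineSubspace.notMem_bot]
    rw [this]
    simp
  · obtain ⟨p, hp⟩ := (AffineSubspace.nonempty_iff_ne_bot _).2 h
    have h1 : (B.inf S).card = Nat.card (B.inf H).direction := by
      rw [← Set.ncard_coe_finset, ← Nat.card_coe_set_eq]
      refine Nat.card_congr (Equiv.subtypeEquiv (Equiv.vaddConst p).symm fun x => ?_)
      change _ ↔ x -ᵥ p ∈ (B.inf H).direction
      rw [Finset.mem_coe, hmem, ← AffineSubspace.vadd_mem_iff_mem_direction _ hp,
        vsub_vadd]
    rw [h1, Module.natCard_eq_pow_finrank (K := K), Nat.cast_pow]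

/-- The hyperplane `x_i - x_j = c` with an integer constant, indexed by the triple `(i, j, c)`. -/
def integralHyperplane (K : Type*) [Field K] {n : ℕ} (e : Fin n × Fin n × ℤ) :
    AffineSubspace K (Fin n → K) :=
  differenceHyperplane K e.1 e.2.1 (e.2.2 : K)

theorem mem_integralHyperplane {K : Type*} [Field K] {n : ℕ} {e : Fin n × Fin n × ℤ}
    {x : Fin n → K} : x ∈ integralHyperplane K e ↔ x e.1 - x e.2.1 = e.2.2 :=
  Iff.rfl

/-- The solutions of a system of equations `x_i - x_j = c` with integer constants are, in the same
way over every field `K`, the translate by `d` of the space of functions that factor through a map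
`π`; unless the equations imply `N = 0` for some nonzero integer `N`. -/
theorem exists_solution_or_contradiction {n : ℕ} (B : Finset (Fin n × Fin n × ℤ)) :
    (∃ N : ℤ, N ≠ 0 ∧ ∀ (K : Type) [Field K], (N : K) ≠ 0 → B.inf (integralHyperplane K) = ⊥) ∨
    ∃ (π : Fin n → Fin n) (d : Fin n → ℤ), ∀ (K : Type) [Field K] (x : Fin n → K),
      x ∈ B.inf (integralHyperplane K) ↔ ∀ k l, π k = π l → x k - d k = x l - d l := by
  classical
  induction B using Finset.induction_on with
  | empty =>
    refine Or.inr ⟨id, 0, fun K _ x => ?_⟩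
    rw [Finset.inf_empty]
    refine ⟨fun _ k l h => ?_, fun _ => AffineSubspace.mem_top _ _ _⟩
    rw [id.eq_1, id.eq_1] at h
    rw [h]
  | insert e B he ih =>
    obtain ⟨i, j, c⟩ := e
    rcases ih with ⟨N, hN, h⟩ | ⟨π, d, h⟩
    · refine Or.inl ⟨N, hN, fun K _ hK => ?_⟩
      rw [Finset.inf_insert, h K hK, inf_bot_eq]
    · by_cases hij : π i = π j
      · by_cases hc : d i - d j - c = 0
        · refine Or.inr ⟨π, d, fun K _ x => ?_⟩
          rw [Finset.inf_insert, AffineSubspace.mem_inf_iff, h, mem_integralHyperplane]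
          refine ⟨fun h' => h'.2, fun h' => ⟨?_, h'⟩⟩
          have h1 := h' i j hij
          have h2 : (d i : K) - d j - c = 0 := by exact_mod_cast congrArg (Int.cast : ℤ → K) hc
          dsimp only
          linear_combination h1 + h2
        · refine Or.inl ⟨_, hc, fun K _ hK => ?_⟩
          rw [← not_not (a := _ = ⊥), ← Ne.eq_1, ← AffineSubspace.nonempty_iff_ne_bot]
          rintro ⟨x, hx⟩
          rw [Finset.inf_insert, SetLike.mem_coe, AffineSubspace.mem_inf_iff, h,
            mem_integralHyperplane] at hx
          have h1 := hx.2 i j hij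
          have h2 := hx.1
          dsimp only at h2
          refine hK ?_
          push_cast
          linear_combination h2 - h1
      · -- merge the class of `i` into that of `j`, shifting `d` on it so that `d i - d j = c`
        refine Or.inr ⟨fun k => if π k = π i then π j else π k,
          fun k => if π k = π i then d k + (c + d j - d i) else d k, fun K _ x => ?_⟩
        rw [Finset.inf_insert, AffineSubspace.mem_inf_iff, h, mem_integralHyperplane]
        have hji : π j ≠ π i := fun h => hij h.symm
        constructor
        · rintro ⟨h1, h2⟩ k l hkl
          dsimp only at h1 hkl ⊢
          split_ifs at hkl ⊢ with hk hl hl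
          · have := h2 k l (hk.trans hl.symm)
            push_cast
            linear_combination this
          · have h3 := h2 k i hk
            have h4 := h2 j l hkl
            push_cast
            linear_combination h3 + h4 + h1
          · have h3 := h2 l i hl
            have h4 := h2 k j hkl
            push_cast
            linear_combination h4 - h3 - h1
          · exact h2 k l hkl
        · intro h1
          constructor
          · have := h1 i j (by simp [hji])
            dsimp only at this ⊢
            rw [if_pos rfl, if_neg hji] at this
            push_cast at this
            linear_combination this
          · intro k l hkl
            have := h1 k l (by simp [hkl])
            dsimp only at this
            rw [hkl] at this
            split_ifs at this
            · push_cast at this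
              linear_combination this
            · exact this

theorem finrank_direction_of_solution {n : ℕ} {K : Type} [Field K]
    {A : AffineSubspace K (Fin n → K)} (π : Fin n → Fin n) (d : Fin n → ℤ)
    (hA : ∀ x, x ∈ A ↔ ∀ k l, π k = π l → x k - d k = x l - d l) :
    A ≠ ⊥ ∧ Module.finrank K A.direction = Nat.card (Set.range π) := by
  have hd : (fun k => (d k : K)) ∈ A := (hA _).2 fun k l _ => by simp
  refine ⟨(AffineSubspace.nonempty_iff_ne_bot _).1 ⟨_, hd⟩, ?_⟩
  have hdir : A.direction = LinearMap.range (LinearMap.funLeft K K (Set.rangeFactorization π)) := by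
    ext v
    rw [← AffineSubspace.vadd_mem_iff_mem_direction v hd, hA, LinearMap.mem_range]
    simp only [vadd_eq_add, Pi.add_apply, add_sub_cancel_right]
    constructor
    · intro h
      refine ⟨fun r => v r.2.choose, funext fun k => ?_⟩
      exact h _ _ (Set.rangeFactorization π k).2.choose_spec
    · rintro ⟨y, rfl⟩ k l hkl
      simp only [LinearMap.funLeft_apply]
      congr 1
      exact Subtype.ext hkl
  rw [hdir, LinearMap.finrank_range_of_inj
    (LinearMap.funLeft_injective_of_surjective K K _ Set.rangeFactorization_surjective),
    Module.finrank_fintype_fun_eq_card, Nat.card_eq_fintype_card]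

/-- For all but finitely many primes, the arrangement of difference hyperplanes with integer
constants has intersections of the same dimensions over the prime field as over the reals. -/
theorem exists_whitneySum_zmod_eq {n : ℕ} (E : Finset (Fin n × Fin n × ℤ)) :
    ∃ N : ℤ, N ≠ 0 ∧ ∀ (p : ℕ) [Fact p.Prime], ¬ (p : ℤ) ∣ N → ∀ t : ℤ,
      whitneySum (integralHyperplane (ZMod p)) t ⊤ E =
        whitneySum (integralHyperplane ℝ) t ⊤ E := by
  classical
  have key : ∀ B : Finset (Fin n × Fin n × ℤ), ∃ N : ℤ, N ≠ 0 ∧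
      ∀ (p : ℕ) [Fact p.Prime], ¬ (p : ℤ) ∣ N →
        (B.inf (integralHyperplane (ZMod p)) = ⊥ ↔ B.inf (integralHyperplane ℝ) = ⊥) ∧
        Module.finrank (ZMod p) (B.inf (integralHyperplane (ZMod p))).direction =
          Module.finrank ℝ (B.inf (integralHyperplane ℝ)).direction := by
    intro B
    rcases exists_solution_or_contradiction B with ⟨N, hN, h⟩ | ⟨π, d, h⟩
    · refine ⟨N, hN, fun p _ hp => ?_⟩
      rw [h ℝ (by exact_mod_cast hN), h (ZMod p) (by rwa [Ne, ZMod.intCast_zmod_eq_zero_iff_dvd]),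
        AffineSubspace.direction_bot, AffineSubspace.direction_bot, finrank_bot, finrank_bot]
      simp
    · refine ⟨1, one_ne_zero, fun p _ _ => ?_⟩
      have h1 := finrank_direction_of_solution π d (h ℝ)
      have h2 := finrank_direction_of_solution π d (h (ZMod p))
      exact ⟨iff_of_false h2.1 h1.1, h2.2.trans h1.2.symm⟩
  choose N hN h using key
  refine ⟨∏ B ∈ E.powerset, N B, Finset.prod_ne_zero_iff.2 fun B _ => hN B, fun p _ hp t => ?_⟩
  unfold whitneySum
  refine Finset.sum_congr rfl fun B hB => ?_
  have h' := h B p fun hd => hp (hd.trans (Finset.dvd_prod_of_mem N hB))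
  rw [top_inf_eq, top_inf_eq, h'.2]
  exact if_congr h'.1 rfl rfl

/-! ### Placements of labels on a line and on a cycle -/

section Placements

open Finset

/-- Passing from `x k` to a later position `x i` adds at most one label per position, so the number
of free positions before a label is monotone in its position. -/
theorem gap_card_le {n : ℕ} {x : Fin n → ℕ} (hx : Function.Injective x) (i k : Fin n) :
    #{l | x l < x i} ≤ #{l | x l < x k} + (x i - x k) := by
  have h1 : ({l | x l < x i} : Finset (Fin n)) ⊆
      ({l | x l < x k} : Finset (Fin n)) ∪ ({l | x k ≤ x l ∧ x l < x i} : Finset (Fin n)) := by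
    intro l
    simp only [mem_filter, mem_univ, true_and, mem_union]
    omega
  have h2 : #{l | x k ≤ x l ∧ x l < x i} ≤ #(Finset.Ico (x k) (x i)) :=
    card_le_card_of_injOn x (by intro l; simp) hx.injOn
  rw [Nat.card_Ico] at h2
  exact (card_le_card h1).trans ((card_union_le _ _).trans (by omega))

/-- If no position between `x k` and `x i` is free, then the labels increase from `k` to `i`. -/
theorem label_lt_of_full {n : ℕ} {x : Fin n → ℕ}
    (hx : ∀ i j, i < j → x i ≠ x j ∧ x i ≠ x j + 1) (t : ℕ) :
    ∀ i k : Fin n, x i = x k + (t + 1) → (∀ a, x k ≤ a → a < x i → ∃ l, x l = a) → k < i := by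
  induction t with
  | zero =>
    intro i k h _
    by_contra hki
    rcases eq_or_lt_of_le (not_lt.1 hki) with rfl | h'
    · omega
    · exact (hx i k h').2 h
  | succ t ih =>
    intro i k h hfull
    obtain ⟨l, hl⟩ := hfull (x k + (t + 1)) (by omega) (by omega)
    have h1 : k < l := ih l k hl fun a ha ha' => hfull a ha (by omega)
    refine h1.trans ?_
    by_contra hki
    rcases eq_or_lt_of_le (not_lt.1 hki) with rfl | h'
    · omega
    · exact (hx i l h').2 (by omega)

/-- The rank (from `0`) of the label `i` when the labels are sorted lexicographically, by their gap
`f i` first and by `i` next. -/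
def lexRank {n m : ℕ} (f : Fin n → Fin m) (i : Fin n) : ℕ :=
  #{k | f k < f i ∨ (f k = f i ∧ k < i)}

theorem lexRank_lt_of_lt {n m : ℕ} {f : Fin n → Fin m} {i k : Fin n}
    (h : f k < f i ∨ (f k = f i ∧ k < i)) : lexRank f k < lexRank f i := by
  refine card_lt_card ((ssubset_iff_of_subset ?_).2 ⟨k, by simpa using h, by simp⟩)
  intro l
  simp only [mem_filter, mem_univ, true_and]
  omega

theorem add_lexRank_lt_iff {n m : ℕ} {f : Fin n → Fin m} {i k : Fin n} :
    (f k : ℕ) + lexRank f k < f i + lexRank f i ↔ f k < f i ∨ (f k = f i ∧ k < i) := by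
  constructor
  · intro h
    by_contra hc
    have h' : k = i ∨ (f i < f k ∨ (f i = f k ∧ i < k)) := by omega
    rcases h' with rfl | h'
    · omega
    · have := lexRank_lt_of_lt h'
      omega
  · intro h
    have := lexRank_lt_of_lt h
    omega

theorem lexRank_lt {n m : ℕ} (f : Fin n → Fin m) (i : Fin n) : lexRank f i < n := by
  have : lexRank f i < #(univ : Finset (Fin n)) :=
    card_lt_card ((ssubset_iff_of_subset (subset_univ _)).2 ⟨i, mem_univ _, by simp⟩)
  simpa using this

/-- Placements of `n` labels on a line of `n + m - 1` positions in which adjacent labels increase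
correspond to the `m ^ n` distributions of the labels among the `m` gaps between the `m - 1` free
positions: the labels of one gap have to be placed in increasing order. -/
theorem card_linear_placements (n m : ℕ) :
    Nat.card {x : Fin n → ℕ // (∀ i, x i + 1 < n + m) ∧
      ∀ i j, i < j → x i ≠ x j ∧ x i ≠ x j + 1} = m ^ n := by
  have hcard : Nat.card (Fin n → Fin m) = m ^ n := by simp
  rw [← hcard]
  symm
  refine Nat.card_congr (Equiv.ofBijective (fun f => ⟨fun i => f i + lexRank f i, ?_, ?_⟩) ⟨?_, ?_⟩)
  · intro i
    have := lexRank_lt f i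
    have := (f i).2
    dsimp only
    omega
  · intro i j hij
    rcases lt_or_ge (f j) (f i) with h | h
    · have := lexRank_lt_of_lt (Or.inl h : f j < f i ∨ (f j = f i ∧ j < i))
      constructor <;> dsimp only <;> omega
    · have h' : f i < f j ∨ (f i = f j ∧ i < j) := by omega
      have := lexRank_lt_of_lt h'
      have : (f i : ℕ) ≤ f j := h
      constructor <;> dsimp only <;> omega
  · -- the gap of `i` is its position minus the number of labels placed before it
    have hleft : ∀ (f : Fin n → Fin m) (i : Fin n),
        (f i : ℕ) = (f i + lexRank f i) - #{k | (f k : ℕ) + lexRank f k < f i + lexRank f i} := by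
      intro f i
      simp_rw [add_lexRank_lt_iff]
      rw [← lexRank, Nat.add_sub_cancel]
    intro f g hfg
    have h := congrArg Subtype.val hfg
    funext i
    apply Fin.ext
    have h' : ∀ i, (f i : ℕ) + lexRank f i = g i + lexRank g i := fun i => congrFun h i
    rw [hleft f i, hleft g i]
    simp_rw [h']
  · rintro ⟨x, hb, hx⟩
    have hinj : Function.Injective x := by
      intro i j h
      rcases lt_trichotomy i j with h' | h' | h'
      · exact absurd h (hx i j h').1
      · exact h'
      · exact absurd h.symm (hx j i h').1
    have hle : ∀ i, #{l | x l < x i} ≤ x i := fun i => by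
      simpa using card_le_card_of_injOn (s := {l | x l < x i}) (t := Finset.range (x i)) x
        (by intro l; simp) hinj.injOn
    have hlt : ∀ i, x i - #{l | x l < x i} < m := fun i => by
      have h1 : #{l | ¬ x l < x i} ≤ #(Finset.Ico (x i) (n + m - 1)) :=
        card_le_card_of_injOn x (by
          intro l
          have := hb l
          simp
          omega) hinj.injOn
      have h2 := card_filter_add_card_filter_not (s := (univ : Finset (Fin n)))
        (fun l => x l < x i)
      rw [Nat.card_Ico] at h1
      rw [card_univ, Fintype.card_fin] at h2
      have := hb i
      have := hle i
      omega
    let f : Fin n → Fin m := fun i => ⟨x i - #{l | x l < x i}, hlt i⟩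
    have hmono : ∀ i k, x k < x i → f k < f i ∨ (f k = f i ∧ k < i) := by
      intro i k h
      have h1 := gap_card_le hinj i k
      have h2 := hle i
      have h3 := hle k
      have h4 : f k ≤ f i := by
        change x k - _ ≤ x i - _
        omega
      rcases h4.lt_or_eq with h5 | h5
      · exact Or.inl h5
      · refine Or.inr ⟨h5, ?_⟩
        have h6 : x k - #{l | x l < x k} = x i - #{l | x l < x i} := congrArg Fin.val h5
        refine label_lt_of_full hx (x i - x k - 1) i k (by omega) fun a ha ha' => ?_
        -- equality in the bound on the number of labels between `x k` and `x i`
        have h7 : #(({l | x k ≤ x l ∧ x l < x i} : Finset (Fin n)).image x) =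
            x i - x k := by
          rw [card_image_of_injective _ hinj]
          have h8 : ({l | x l < x i} : Finset (Fin n)) =
              ({l | x l < x k} : Finset (Fin n)) ∪
                ({l | x k ≤ x l ∧ x l < x i} : Finset (Fin n)) := by
            ext l
            simp only [mem_filter, mem_univ, true_and, mem_union]
            omega
          have h9 : Disjoint ({l | x l < x k} : Finset (Fin n))
              ({l | x k ≤ x l ∧ x l < x i} : Finset (Fin n)) := by
            rw [Finset.disjoint_filter]
            intro l _ h
            omega
          have h10 := congrArg Finset.card h8
          rw [card_union_of_disjoint h9] at h10
          omega
        have h8 : ({l | x k ≤ x l ∧ x l < x i} : Finset (Fin n)).image x =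
            Finset.Ico (x k) (x i) := by
          refine eq_of_subset_of_card_le ?_ ?_
          · intro a
            simp only [mem_image, mem_filter, mem_univ, true_and, Finset.mem_Ico]
            rintro ⟨l, hl, rfl⟩
            exact hl
          · rw [h7, Nat.card_Ico]
        have h9 : a ∈ ({l | x k ≤ x l ∧ x l < x i} : Finset (Fin n)).image x := by
          rw [h8, Finset.mem_Ico]
          exact ⟨ha, ha'⟩
        obtain ⟨l, -, hl⟩ := Finset.mem_image.1 h9
        exact ⟨l, hl⟩
    have hiff : ∀ i k, (f k < f i ∨ (f k = f i ∧ k < i)) ↔ x k < x i := by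
      intro i k
      refine ⟨fun h => ?_, hmono i k⟩
      by_contra hc
      rcases (not_lt.1 hc).lt_or_eq with h' | h'
      · have := hmono k i h'
        omega
      · have := hinj h'
        subst this
        omega
    refine ⟨f, Subtype.ext (funext fun i => ?_)⟩
    change (x i - #{l | x l < x i}) + #{k | f k < f i ∨ (f k = f i ∧ k < i)} = x i
    simp_rw [hiff]
    exact Nat.sub_add_cancel (hle i)

/-- The placements `x` of the labels `i : Fin n` on a cycle of `q` positions in which different labels
have different positions and a label directly following another one is the larger of the two. For
prime `q` they are the points of the complement of the Shi arrangement over `ℤ / q`. -/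
abbrev CyclicPlacement (n q : ℕ) : Type :=
  {x : Fin n → ZMod q // ∀ i j, i < j → x i ≠ x j ∧ x i ≠ x j + 1}

/-- Cutting the cycle at a free position leaves a line. -/
theorem card_cyclicPlacement_zero_free (n m : ℕ) (hm : 0 < m) :
    Nat.card {x : CyclicPlacement n (n + m) // ∀ i, x.1 i ≠ 0} = m ^ n := by
  have : NeZero (n + m) := ⟨by omega⟩
  rw [← card_linear_placements n m]
  have hval : ∀ a : ZMod (n + m), a ≠ 0 → ∃ b : ℕ, b + 1 < n + m ∧ a = ((b + 1 : ℕ) : ZMod (n + m))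
      := by
    intro a ha
    have h1 := ZMod.val_lt a
    have h2 : a.val ≠ 0 := by rwa [Ne, ZMod.val_eq_zero]
    refine ⟨a.val - 1, by omega, ?_⟩
    rw [Nat.sub_add_cancel (by omega), ZMod.natCast_zmod_val]
  have hcast : ∀ a b : ℕ, a < n + m → b < n + m →
      ((a : ZMod (n + m)) = (b : ZMod (n + m)) ↔ a = b) := by
    intro a b ha hb
    rw [ZMod.natCast_eq_natCast_iff', Nat.mod_eq_of_lt ha, Nat.mod_eq_of_lt hb]
  have hne : ∀ a : ℕ, a + 1 < n + m → ((a + 1 : ℕ) : ZMod (n + m)) ≠ 0 := by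
    intro a ha h
    have := (hcast (a + 1) 0 ha (by omega)).1 (by simpa using h)
    omega
  -- position `a` on the line becomes position `a + 1` on the cycle
  have hiff : ∀ a b : ℕ, a + 1 < n + m → b + 1 < n + m →
      (((a + 1 : ℕ) : ZMod (n + m)) = ((b + 1 : ℕ) : ZMod (n + m)) + 1 ↔ a = b + 1) := by
    intro a b ha hb
    rcases Nat.lt_or_ge (b + 1 + 1) (n + m) with h | h
    · rw [← Nat.cast_succ, hcast _ _ ha h]
      omega
    · have h0 : b + 1 + 1 = n + m := by omega
      rw [← Nat.cast_succ, Nat.succ_eq_add_one, h0, ZMod.natCast_self]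
      exact ⟨fun h => absurd h (hne a ha), fun h => by omega⟩
  symm
  refine Nat.card_congr (Equiv.ofBijective
    (fun x => ⟨⟨fun i => ((x.1 i + 1 : ℕ) : ZMod (n + m)), fun i j hij => ⟨?_, ?_⟩⟩,
      fun i => hne _ (x.2.1 i)⟩) ⟨?_, ?_⟩)
  · rw [Ne, hcast _ _ (x.2.1 i) (x.2.1 j), Nat.add_right_cancel_iff]
    exact (x.2.2 i j hij).1
  · rw [Ne, hiff _ _ (x.2.1 i) (x.2.1 j)]
    exact (x.2.2 i j hij).2
  · intro x y h
    refine Subtype.ext (funext fun i => ?_)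
    have h' := congrFun (congrArg Subtype.val (congrArg Subtype.val h)) i
    simpa using (hcast _ _ (x.2.1 i) (y.2.1 i)).1 h'
  · rintro ⟨⟨x, hx⟩, h0⟩
    choose y hy hxy using fun i => hval (x i) (h0 i)
    refine ⟨⟨y, hy, fun i j hij => ⟨?_, ?_⟩⟩, ?_⟩
    · have := (hx i j hij).1
      rw [hxy i, hxy j, Ne, hcast _ _ (hy i) (hy j), Nat.add_right_cancel_iff] at this
      exact this
    · have := (hx i j hij).2
      rwa [hxy i, hxy j, Ne, hiff _ _ (hy i) (hy j)] at this
    · refine Subtype.ext (Subtype.ext (funext fun i => (hxy i).symm))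

theorem CyclicPlacement.injective {n q : ℕ} (x : CyclicPlacement n q) :
    Function.Injective x.1 := by
  intro i j h
  rcases lt_trichotomy i j with h' | h' | h'
  · exact absurd h (x.2 i j h').1
  · exact h'
  · exact absurd h.symm (x.2 j i h').1

/-- A cycle all of whose positions are occupied cannot have increasing adjacent labels. -/
theorem isEmpty_cyclicPlacement_self (n : ℕ) (hn : 2 ≤ n) : IsEmpty (CyclicPlacement n n) := by
  refine ⟨fun x => ?_⟩
  have : NeZero n := ⟨by omega⟩
  have : Fact (1 < n) := ⟨by omega⟩
  have hb : Function.Bijective x.1 :=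
    (Fintype.bijective_iff_injective_and_card _).2 ⟨x.injective, by simp⟩
  -- the label following the largest one is smaller
  let i : Fin n := ⟨n - 1, by omega⟩
  obtain ⟨j, hj⟩ := hb.2 (x.1 i + 1)
  have hji : j ≠ i := by
    rintro rfl
    simp at hj
  have hlt : j < i := by
    rw [Fin.lt_def]
    have := j.2
    have : (j : ℕ) ≠ n - 1 := fun h => hji (Fin.ext h)
    change (j : ℕ) < n - 1
    omega
  exact (x.2 j i hlt).2 hj

/-- Rotation makes any prescribed position the origin. -/
theorem card_cyclicPlacement_free (n q : ℕ) (a : ZMod q) :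
    Nat.card {x : CyclicPlacement n q // ∀ i, x.1 i ≠ a} =
      Nat.card {x : CyclicPlacement n q // ∀ i, x.1 i ≠ 0} := by
  refine Nat.card_congr (Equiv.subtypeEquiv (Equiv.subtypeEquiv
    (Equiv.subRight (fun _ : Fin n => a)) ?_) ?_)
  · intro x
    refine forall_congr' fun i => forall_congr' fun j => forall_congr' fun _ => ?_
    simp only [Equiv.subRight_apply, Pi.sub_apply, Ne, sub_left_inj]
    rw [sub_add_eq_add_sub, sub_left_inj]
  · intro x
    refine forall_congr' fun i => ?_
    simp [sub_eq_zero]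

/-- Each placement has `q - n` free positions, and each position is free in `(q - n) ^ n` placements.
This determines the number of placements if `q > n`; for `q = n` there are none, unless `n = 1`. -/
theorem card_cyclicPlacement (n q : ℕ) (hn : 1 ≤ n) (hq : n ≤ q) :
    Nat.card (CyclicPlacement n q) = q * (q - n) ^ (n - 1) := by
  classical
  have : NeZero q := ⟨by omega⟩
  rcases hq.eq_or_lt with rfl | hlt
  · rcases hn.eq_or_lt with rfl | hn2
    · have : Nat.card (CyclicPlacement 1 1) = Nat.card (Fin 1 → ZMod 1) :=
        Nat.card_congr (Equiv.subtypeUnivEquiv fun x i j hij => by omega)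
      rw [this]
      simp
    · have := isEmpty_cyclicPlacement_self n hn2
      rw [Nat.card_of_isEmpty, Nat.sub_self, zero_pow (by omega), mul_zero]
  · obtain ⟨m, rfl⟩ := Nat.exists_eq_add_of_lt hlt
    -- count the pairs of a placement and a free position in two ways
    have h1 : ∑ a : ZMod (n + m + 1), #{x : CyclicPlacement n (n + m + 1) | ∀ i, x.1 i ≠ a} =
        ∑ x : CyclicPlacement n (n + m + 1), #{a : ZMod (n + m + 1) | ∀ i, x.1 i ≠ a} := by
      simp_rw [card_filter]
      exact sum_comm
    have h2 : ∀ a : ZMod (n + m + 1), #{x : CyclicPlacement n (n + m + 1) | ∀ i, x.1 i ≠ a} =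
        (m + 1) ^ n := by
      intro a
      rw [← card_cyclicPlacement_zero_free n (m + 1) (by omega)]
      refine Eq.trans ?_ (card_cyclicPlacement_free n (n + m + 1) a)
      rw [Nat.card_eq_fintype_card, Fintype.card_subtype]
    have h3 : ∀ x : CyclicPlacement n (n + m + 1),
        #{a : ZMod (n + m + 1) | ∀ i, x.1 i ≠ a} = m + 1 := by
      intro x
      have : ({a : ZMod (n + m + 1) | ∀ i, x.1 i ≠ a} : Finset _) = (univ.image x.1)ᶜ := by
        ext a
        simp
      rw [this, card_compl, card_image_of_injective _ x.injective, ZMod.card, card_univ,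
        Fintype.card_fin]
      omega
    simp_rw [h2, h3] at h1
    rw [sum_const, sum_const, card_univ, card_univ, ZMod.card, smul_eq_mul, smul_eq_mul,
      ← Nat.card_eq_fintype_card] at h1
    have h4 : n + m + 1 - n = m + 1 := by omega
    rw [h4]
    obtain ⟨k, rfl⟩ := Nat.exists_eq_add_of_le' hn
    rw [pow_succ, ← mul_assoc] at h1
    exact (Nat.eq_of_mul_eq_mul_right (Nat.succ_pos m) h1).symm

/-! ### The Shi arrangement -/

/-- The index triples of the hyperplanes of the Shi arrangement. -/
def shiIndices (n : ℕ) : Finset (Fin n × Fin n × ℤ) :=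
  (univ ×ˢ univ ×ˢ {0, 1}).filter fun e => e.1 < e.2.1

open Classical in
theorem shiArrangement_eq_image (K : Type*) [Field K] (n : ℕ) :
    shiArrangement K n = (shiIndices n).image (integralHyperplane K) := by
  ext A
  simp only [shiArrangement, shiIndices, mem_union, mem_image, mem_filter, mem_univ, true_and,
    Prod.exists, mem_product, mem_insert, mem_singleton, integralHyperplane]
  constructor
  · rintro (⟨i, j, hij, rfl⟩ | ⟨i, j, hij, rfl⟩)
    · exact ⟨i, j, 0, ⟨Or.inl rfl, hij⟩, by simp⟩
    · exact ⟨i, j, 1, ⟨Or.inr rfl, hij⟩, by simp⟩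
  · rintro ⟨i, j, c, ⟨rfl | rfl, hij⟩, rfl⟩
    · exact Or.inl ⟨i, j, hij, by simp⟩
    · exact Or.inr ⟨i, j, hij, by simp⟩

theorem integralHyperplane_ne_top {n : ℕ} {e : Fin n × Fin n × ℤ} (he : e ∈ shiIndices n) :
    integralHyperplane ℝ e ≠ ⊤ := by
  intro h
  have hlt : e.1 < e.2.1 := (mem_filter.1 he).2
  have hmem : ∀ x : Fin n → ℝ, x e.1 - x e.2.1 = e.2.2 := fun x =>
    mem_integralHyperplane.1 (h ▸ AffineSubspace.mem_top ℝ _ x)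
  have h0 := hmem 0
  have h1 := hmem (Pi.single e.1 1)
  rw [Pi.single_eq_same, Pi.single_eq_of_ne hlt.ne', ← h0] at h1
  simp at h1

theorem card_arrangementComplement_shi (n p : ℕ) [Fact p.Prime] (hn : 1 ≤ n) (hp : n ≤ p) :
    Nat.card (arrangementComplement (shiArrangement (ZMod p) n)) = p * (p - n) ^ (n - 1) := by
  classical
  rw [← card_cyclicPlacement n p hn hp, shiArrangement_eq_image]
  refine Nat.card_congr (Equiv.subtypeEquivRight fun x => ?_)
  simp only [arrangementComplement, Set.mem_compl_iff, Set.mem_iUnion, SetLike.mem_coe,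
    mem_image, shiIndices, mem_filter, mem_product, mem_univ, true_and, mem_insert, mem_singleton]
  constructor
  · intro h i j hij
    constructor
    · intro hx
      refine h ⟨_, ⟨(i, j, 0), ⟨Or.inl rfl, hij⟩, rfl⟩, mem_integralHyperplane.2 ?_⟩
      simp [hx]
    · intro hx
      refine h ⟨_, ⟨(i, j, 1), ⟨Or.inr rfl, hij⟩, rfl⟩, mem_integralHyperplane.2 ?_⟩
      simp [hx]
  · rintro h ⟨_, ⟨⟨i, j, c⟩, ⟨hc, hij⟩, rfl⟩, hx⟩
    rw [mem_integralHyperplane] at hx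
    dsimp only at hc hij hx
    rcases hc with rfl | rfl
    · exact (h i j hij).1 (sub_eq_zero.1 (by simpa using hx))
    · exact (h i j hij).2 (by rw [← sub_eq_iff_eq_add']; simpa using hx)

theorem eval_arrangementCharpoly_shi (n : ℕ) (t : ℤ) :
    (arrangementCharpoly (shiArrangement ℝ n)).eval t =
      whitneySum (integralHyperplane ℝ) t ⊤ (shiIndices n) := by
  rw [shiArrangement_eq_image, arrangementCharpoly_image _ _ fun e he =>
    integralHyperplane_ne_top he]
  simpa using map_whitneySum (Polynomial.evalRingHom t) (integralHyperplane ℝ)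
    (Polynomial.X : Polynomial ℤ) ⊤ (shiIndices n)

/-- The finite field method: the characteristic polynomial takes the value `p * (p - n) ^ (n - 1)`
at all large primes `p`. -/
theorem arrangementCharpoly_shi (n : ℕ) (hn : 1 ≤ n) :
    arrangementCharpoly (shiArrangement ℝ n) =
      Polynomial.X * (Polynomial.X - Polynomial.C (n : ℤ)) ^ (n - 1) := by
  classical
  obtain ⟨N, hN, h⟩ := exists_whitneySum_zmod_eq (shiIndices n)
  refine Polynomial.eq_of_infinite_eval_eq _ _ ?_
  have hinf : {p : ℕ | p.Prime ∧ N.natAbs + n < p}.Infinite := by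
    refine Set.infinite_of_not_bddAbove ?_
    rintro ⟨M, hM⟩
    obtain ⟨p, hp, hp'⟩ := Nat.exists_infinite_primes (M + N.natAbs + n + 1)
    have := hM (⟨hp', by omega⟩ : p.Prime ∧ N.natAbs + n < p)
    omega
  refine (hinf.image (f := fun p : ℕ => (p : ℤ)) Nat.cast_injective.injOn).mono ?_
  rintro _ ⟨p, ⟨hp, hlt⟩, rfl⟩
  have : Fact p.Prime := ⟨hp⟩
  have hdvd : ¬ (p : ℤ) ∣ N := fun hd => by
    have := Nat.le_of_dvd (Int.natAbs_pos.2 hN) (Int.natCast_dvd.1 hd)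
    omega
  have h1 := card_arrangementComplement_image (integralHyperplane (ZMod p)) (shiIndices n)
  rw [← shiArrangement_eq_image, card_arrangementComplement_shi n p hn (by omega), Nat.card_zmod,
    h p hdvd] at h1
  change Polynomial.eval (p : ℤ) _ = Polynomial.eval (p : ℤ) _
  rw [eval_arrangementCharpoly_shi, ← h1]
  push_cast [Nat.cast_sub (show n ≤ p by omega)]
  simp

theorem numRegions_shi (n : ℕ) (hn : 1 ≤ n) :
    numRegions (shiArrangement ℝ n) = (n + 1) ^ (n - 1) := by
  classical
  let f : Fin n × Fin n × ℤ → (Fin n → ℝ) →ᵃ[ℝ] ℝ := fun e =>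
    ((LinearMap.proj e.1 : (Fin n → ℝ) →ₗ[ℝ] ℝ) - LinearMap.proj e.2.1).toAffineMap -
      AffineMap.const ℝ _ (e.2.2 : ℝ)
  have hf : ∀ e x, x ∈ integralHyperplane ℝ e ↔ f e x = 0 := by
    intro e x
    rw [mem_integralHyperplane, ← sub_eq_zero]
    rfl
  have h := ncard_signPatterns hf (shiIndices n) ⊤
  rw [← numRegions_image hf, ← shiArrangement_eq_image, ← eval_arrangementCharpoly_shi,
    arrangementCharpoly_shi n hn, AffineSubspace.direction_top, finrank_top,
    Module.finrank_fin_fun] at h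
  obtain ⟨k, rfl⟩ := Nat.exists_eq_add_of_le' hn
  rw [Nat.add_sub_cancel] at h ⊢
  have h2 : (-1 : ℤ) - ((k + 1 : ℕ) : ℤ) = (-1) * ((k + 1 + 1 : ℕ) : ℤ) := by
    push_cast
    ring
  have h3 : ((-1 : ℤ) ^ k) * (-1) ^ k = 1 := by
    rw [← pow_add, Even.neg_one_pow (Even.add_self _)]
  rw [Polynomial.eval_mul, Polynomial.eval_pow, Polynomial.eval_sub, Polynomial.eval_X,
    Polynomial.eval_C, h2, mul_pow, pow_succ] at h
  have h4 : (numRegions (shiArrangement ℝ (k + 1)) : ℤ) = ((k + 1 + 1 : ℕ) : ℤ) ^ k := by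
    rw [h]
    linear_combination ((k + 1 + 1 : ℕ) : ℤ) ^ k * h3
  exact_mod_cast h4

end Placements

theorem mainTheorem4 (n : ℕ) (hn : 1 ≤ n) :
    arrangementCharpoly (shiArrangement ℝ n) =
        Polynomial.X * (Polynomial.X - Polynomial.C (n : ℤ)) ^ (n - 1) ∧
      numRegions (shiArrangement ℝ n) = (n + 1) ^ (n - 1) ∧
      ∀ p : ℕ, ∀ _ : Fact p.Prime, n ≤ p →
        Nat.card (arrangementComplement (shiArrangement (ZMod p) n)) =
          p * (p - n) ^ (n - 1) :=
  ⟨arrangementCharpoly_shi n hn, numRegions_shi n hn,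
    fun p _ hp => card_arrangementComplement_shi n p hn hp⟩
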